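/- Let $\mathcal M$ be the measure algebra, i.e. the Boolean algebra of Lebesgue measurable subsets of $[0,1]$ modulo Lebesgue null sets; let $\mathrm{Aut}\,\mathcal M$ be the group of its Boolean algebra automorphisms, and $\mathrm{MPAut}\,\mathcal M$ the subgroup of those automorphisms that preserve the measure. Let $\mathcal P(\mathbb N)/\mathrm{fin}$ be the Boolean algebra of subsets of $\mathbb N$ modulo finite sets. Let $T^*_\omega$ be the group of its trivial automorphisms, i.e. those of the form $[X]\mapsto[e(X\cap A)]$ for some bijection $e:A\to B$ between cofinite subsets $A,B\subseteq\mathbb N$. Let $S^*_\omega\le T^*_\omega$ be the subgroup of the automorphisms induced by permutations of $\mathbb N$ (equivalently, the group of all permutations of $\mathbb N$ modulo the normal subgroup of permutations moving only finitely many points). Then neither of the groups $\mathrm{Aut}\,\mathcal M$ and $\mathrm{MPAut}\,\mathcal M$ is isomorphic, as an abstract group, to $T^*_\omega$ or to $S^*_\omega$; that is, $\mathrm{Aut}\,\mathcal M\not\cong T^*_\omega$, $\mathrm{Aut}\,\mathcal M\not\cong S^*_\omega$, $\mathrm{MPAut}\,\mathcal M\not\cong T^*_\omega$ and $\mathrm{MPAut}\,\mathcal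 M\not\cong S^*_\omega$. -/

import Mathlib

open MeasureTheory

/-! ## Quotient of a Boolean algebra by an ideal -/

/-- Congruence modulo an ideal `I` of a Boolean algebra: the symmetric difference lies in `I`. -/
@[reducible]
def idealSetoid {B : Type*} [BooleanAlgebra B] (I : Order.Ideal B) : Setoid B where
  r a b := symmDiff a b ∈ I
  iseqv :=
    { refl := fun a => by simp
      symm := fun {a b} h => by rwa [symmDiff_comm]
      trans := fun {a b c} h k =>
        I.lower (symmDiff_triangle a b c) (Order.Ideal.sup_mem h k) }

/-- The quotient `B / I` of a Boolean algebra `B` by an ideal `I`. -/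
def BoolQuotient {B : Type*} [BooleanAlgebra B] (I : Order.Ideal B) : Type _ :=
  Quotient (idealSetoid I)

namespace BoolQuotient

variable {B : Type*} [BooleanAlgebra B] {I : Order.Ideal B}

/-- The class of `a` in `B / I`. -/
def mk (I : Order.Ideal B) (a : B) : BoolQuotient I := Quotient.mk (idealSetoid I) a

theorem mk_eq_mk {a b : B} : mk I a = mk I b ↔ symmDiff a b ∈ I :=
  ⟨fun h => Quotient.exact h, fun h => Quotient.sound h⟩

theorem mk_surjective : Function.Surjective (mk I) := fun x => Quotient.exists_rep x

theorem symmDiff_mem {a b : B} : symmDiff a b ∈ I ↔ a \ b ∈ I ∧ b \ a ∈ I :=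
  Order.Ideal.sup_mem_iff

theorem sdiff_mem_trans {a b c : B} (h : a \ b ∈ I) (k : b \ c ∈ I) : a \ c ∈ I :=
  I.lower (sdiff_triangle a b c) (Order.Ideal.sup_mem h k)

/-- `[a] ≤ [b]` iff `a \ b ∈ I`. -/
instance : LE (BoolQuotient I) where
  le := Quotient.lift₂ (s₁ := idealSetoid I) (s₂ := idealSetoid I) (fun a b => a \ b ∈ I) (by
    intro a b a' b' ha hb
    have ha' := symmDiff_mem.1 ha
    have hb' := symmDiff_mem.1 hb
    exact propext
      ⟨fun h => sdiff_mem_trans ha'.2 (sdiff_mem_trans h hb'.1),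
        fun h => sdiff_mem_trans ha'.1 (sdiff_mem_trans h hb'.2)⟩)

theorem mk_le_mk {a b : B} : mk I a ≤ mk I b ↔ a \ b ∈ I := Iff.rfl

theorem mk_mono {a b : B} (h : a ≤ b) : mk I a ≤ mk I b := by
  rw [mk_le_mk, sdiff_eq_bot_iff.2 h]; exact I.bot_mem

instance : PartialOrder (BoolQuotient I) where
  le_refl := by
    rintro ⟨a⟩; exact mk_mono le_rfl
  le_trans := by
    rintro ⟨a⟩ ⟨b⟩ ⟨c⟩ h k; exact sdiff_mem_trans (I := I) h k
  le_antisymm := by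
    rintro ⟨a⟩ ⟨b⟩ h k; exact mk_eq_mk.2 (symmDiff_mem.2 ⟨h, k⟩)

/-- The operations of `B / I` are those of `B` on representatives. -/
instance : BooleanAlgebra (BoolQuotient I) where
  sup := Quotient.map₂ (· ⊔ ·) (by
    intro a a' h b b' k
    have h' := symmDiff_mem.1 h
    have k' := symmDiff_mem.1 k
    refine symmDiff_mem.2 ⟨?_, ?_⟩
    · rw [sup_sdiff]
      exact Order.Ideal.sup_mem (I.lower (sdiff_le_sdiff_left le_sup_left) h'.1)
        (I.lower (sdiff_le_sdiff_left le_sup_right) k'.1)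
    · rw [sup_sdiff]
      exact Order.Ideal.sup_mem (I.lower (sdiff_le_sdiff_left le_sup_left) h'.2)
        (I.lower (sdiff_le_sdiff_left le_sup_right) k'.2))
  inf := Quotient.map₂ (· ⊓ ·) (by
    intro a a' h b b' k
    have h' := symmDiff_mem.1 h
    have k' := symmDiff_mem.1 k
    refine symmDiff_mem.2 ⟨?_, ?_⟩
    · rw [sdiff_inf]
      exact Order.Ideal.sup_mem (I.lower (sdiff_le_sdiff_right inf_le_left) h'.1)
        (I.lower (sdiff_le_sdiff_right inf_le_right) k'.1)
    · rw [sdiff_inf]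
      exact Order.Ideal.sup_mem (I.lower (sdiff_le_sdiff_right inf_le_left) h'.2)
        (I.lower (sdiff_le_sdiff_right inf_le_right) k'.2))
  compl := Quotient.map (·ᶜ) (by
    intro a a' h
    change symmDiff aᶜ a'ᶜ ∈ I
    rw [compl_symmDiff_compl]; exact h)
  top := mk I ⊤
  bot := mk I ⊥
  le_sup_left := by rintro ⟨a⟩ ⟨b⟩; exact mk_mono (I := I) (le_sup_left (a := a) (b := b))
  le_sup_right := by rintro ⟨a⟩ ⟨b⟩; exact mk_mono (I := I) (le_sup_right (a := a) (b := b))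
  sup_le := by
    rintro ⟨a⟩ ⟨b⟩ ⟨c⟩ h k
    change (a ⊔ b) \ c ∈ I
    rw [sup_sdiff]; exact Order.Ideal.sup_mem h k
  inf_le_left := by rintro ⟨a⟩ ⟨b⟩; exact mk_mono (I := I) (inf_le_left (a := a) (b := b))
  inf_le_right := by rintro ⟨a⟩ ⟨b⟩; exact mk_mono (I := I) (inf_le_right (a := a) (b := b))
  le_inf := by
    rintro ⟨a⟩ ⟨b⟩ ⟨c⟩ h k
    change a \ (b ⊓ c) ∈ I
    rw [sdiff_inf]; exact Order.Ideal.sup_mem h k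
  le_sup_inf := by
    rintro ⟨a⟩ ⟨b⟩ ⟨c⟩; exact mk_mono (I := I) (le_sup_inf (x := a) (y := b) (z := c))
  inf_compl_le_bot := by
    rintro ⟨a⟩; exact mk_mono (I := I) (inf_compl_self a).le
  top_le_sup_compl := by
    rintro ⟨a⟩; exact mk_mono (I := I) (sup_compl_eq_top (x := a)).ge
  le_top := by rintro ⟨a⟩; exact mk_mono (I := I) (le_top (a := a))
  bot_le := by rintro ⟨a⟩; exact mk_mono (I := I) (bot_le (a := a))

end BoolQuotient

/-- The group of automorphisms of a Boolean algebra (under composition). Since the Boolean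
operations are determined by the order, these are the order automorphisms. -/
abbrev BoolAut (B : Type*) [BooleanAlgebra B] : Type _ := B ≃o B

/-! ## The measure algebra -/

/-- The ideal of null sets in the Boolean algebra of measurable sets. -/
def nullIdeal {X : Type*} [MeasurableSpace X] (μ : Measure X) :
    Order.Ideal {s : Set X // MeasurableSet s} where
  carrier := {s | μ (s : Set X) = 0}
  lower' := fun _ _ h hs => measure_mono_null h hs
  nonempty' := ⟨⊥, measure_empty⟩
  directed' := fun s hs t ht => ⟨s ⊔ t, measure_union_null hs ht, le_sup_left, le_sup_right⟩

/-- The algebra of measurable sets modulo null sets. -/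
abbrev MeasAlg {X : Type*} [MeasurableSpace X] (μ : Measure X) : Type _ :=
  BoolQuotient (nullIdeal μ)

/-- The measure of an element of the algebra of measurable sets modulo null sets. -/
noncomputable def MeasAlg.meas {X : Type*} [MeasurableSpace X] (μ : Measure X) :
    MeasAlg μ → ENNReal :=
  Quotient.lift (s := idealSetoid (nullIdeal μ)) (fun s => μ (s : Set X)) (fun _ _ h =>
    measure_congr (measure_symmDiff_eq_zero_iff.1 h))

/-- The measure algebra: Lebesgue measurable subsets of `[0,1]` modulo Lebesgue null sets
(every Lebesgue measurable set is a Borel set up to a null set). -/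
abbrev LebesgueAlg : Type := MeasAlg (volume : Measure unitInterval)

/-- The automorphisms of the measure algebra that preserve the measure. -/
def MPAut : Subgroup (BoolAut LebesgueAlg) where
  carrier := {f | ∀ a, MeasAlg.meas volume (f a) = MeasAlg.meas volume a}
  mul_mem' := fun {f g} hf hg a => (hf (g a)).trans (hg a)
  one_mem' := fun _ => rfl
  inv_mem' := fun {f} hf a => by
    have h := hf (f⁻¹ a)
    rw [RelIso.apply_inv_self] at h
    exact h.symm

/-! ## Automorphisms of `P(ℕ)/fin` -/

/-- The ideal of finite sets of natural numbers. -/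
def finIdeal : Order.Ideal (Set ℕ) where
  carrier := {s | s.Finite}
  lower' := fun _ _ h hs => hs.subset h
  nonempty' := ⟨∅, Set.finite_empty⟩
  directed' := fun s hs t ht => ⟨s ∪ t, hs.union ht, Set.subset_union_left, Set.subset_union_right⟩

/-- The Boolean algebra `P(ℕ)/fin`. -/
abbrev PNFin : Type := BoolQuotient finIdeal

/-- The class of a set of natural numbers in `P(ℕ)/fin`. -/
abbrev PNFin.mk (X : Set ℕ) : PNFin := BoolQuotient.mk finIdeal X

/-- `f` is induced by the bijection `e` between two subsets `e.source` and `e.target` of `ℕ`: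
`f [X] = [e(X ∩ e.source)]`. -/
def InducedBy (f : BoolAut PNFin) (e : PartialEquiv ℕ ℕ) : Prop :=
  ∀ X : Set ℕ, f (PNFin.mk X) = PNFin.mk (e '' (X ∩ e.source))

theorem finite_compl_source_trans {e e' : PartialEquiv ℕ ℕ} (h : e.sourceᶜ.Finite)
    (h' : e'.sourceᶜ.Finite) : (e.trans e').sourceᶜ.Finite := by
  have h2 : (e.source ∩ e ⁻¹' e'.sourceᶜ).Finite :=
    Set.Finite.of_finite_image (h'.subset (by rintro _ ⟨x, hx, rfl⟩; exact hx.2))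
      (e.injOn.mono Set.inter_subset_left)
  refine (h.union h2).subset fun x hx => ?_
  rw [PartialEquiv.trans_source] at hx
  by_cases hs : x ∈ e.source
  · exact Or.inr ⟨hs, fun hx' => hx ⟨hs, hx'⟩⟩
  · exact Or.inl hs

theorem finite_compl_target_trans {e e' : PartialEquiv ℕ ℕ} (h : e.targetᶜ.Finite)
    (h' : e'.targetᶜ.Finite) : (e.trans e').targetᶜ.Finite :=
  finite_compl_source_trans (e := e'.symm) (e' := e.symm) h' h

theorem InducedBy.mul {f g : BoolAut PNFin} {e e' : PartialEquiv ℕ ℕ} (hf : InducedBy f e)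
    (hg : InducedBy g e') : InducedBy (f * g) (e'.trans e) := by
  intro X
  rw [RelIso.mul_apply, hg X, hf]
  congr 1
  ext y
  simp only [Set.mem_image, Set.mem_inter_iff, PartialEquiv.trans_source, PartialEquiv.coe_trans,
    Set.mem_preimage, Function.comp_apply]
  constructor
  · rintro ⟨_, ⟨⟨x, ⟨hX, hs⟩, rfl⟩, h⟩, rfl⟩
    exact ⟨x, ⟨hX, hs, h⟩, rfl⟩
  · rintro ⟨x, ⟨hX, hs, h⟩, rfl⟩
    exact ⟨_, ⟨⟨x, ⟨hX, hs⟩, rfl⟩, h⟩, rfl⟩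

theorem InducedBy.inv {f : BoolAut PNFin} {e : PartialEquiv ℕ ℕ} (ht : e.targetᶜ.Finite)
    (hf : InducedBy f e) : InducedBy f⁻¹ e.symm := by
  intro X
  apply f.injective
  rw [RelIso.apply_inv_self, hf]
  have h : e '' (e.symm '' (X ∩ e.symm.source) ∩ e.source) = X ∩ e.target := by
    ext y
    constructor
    · rintro ⟨_, ⟨⟨x, ⟨hX, hx⟩, rfl⟩, -⟩, rfl⟩
      rw [PartialEquiv.symm_source] at hx
      rw [e.right_inv hx]; exact ⟨hX, hx⟩
    · rintro ⟨hX, hy⟩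
      exact ⟨e.symm y, ⟨⟨y, ⟨hX, hy⟩, rfl⟩, e.map_target hy⟩, e.right_inv hy⟩
  rw [h]
  refine BoolQuotient.mk_eq_mk.2 (BoolQuotient.symmDiff_mem.2 ⟨ht.subset ?_, ?_⟩)
  · exact fun y hy hy' => hy.2 ⟨hy.1, hy'⟩
  · have : (X ∩ e.target) \ X = ∅ := by ext; simp; tauto
    rw [this]; exact Set.finite_empty

/-- The group `T*_ω` of trivial automorphisms of `P(ℕ)/fin`: those induced by a bijection between
two cofinite subsets of `ℕ`. -/
def TrivialAut : Subgroup (BoolAut PNFin) where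
  carrier := {f | ∃ e : PartialEquiv ℕ ℕ, e.sourceᶜ.Finite ∧ e.targetᶜ.Finite ∧ InducedBy f e}
  mul_mem' := by
    rintro f g ⟨e, hs, ht, h⟩ ⟨e', hs', ht', h'⟩
    exact ⟨e'.trans e, finite_compl_source_trans hs' hs, finite_compl_target_trans ht' ht,
      h.mul h'⟩
  one_mem' := ⟨PartialEquiv.refl ℕ, by simp, by simp, fun X => by simp⟩
  inv_mem' := by
    rintro f ⟨e, hs, ht, h⟩
    exact ⟨e.symm, ht, hs, h.inv ht⟩

/-- The group `S*_ω` of permutations of `ℕ` modulo finite changes, realised as the group of "very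
trivial" automorphisms of `P(ℕ)/fin`: those induced by a permutation of `ℕ`. Every permutation
induces one (`exists_inducedBy`), and two permutations induce the same one iff they differ at
finitely many points only (`inducedBy_unique`). -/
def VeryTrivialAut : Subgroup (BoolAut PNFin) where
  carrier := {f | ∃ σ : Equiv.Perm ℕ, InducedBy f σ.toPartialEquiv}
  mul_mem' := by
    rintro f g ⟨σ, h⟩ ⟨τ, k⟩
    refine ⟨σ * τ, ?_⟩
    intro X
    simpa using h.mul k X
  one_mem' := ⟨1, fun X => by simp⟩
  inv_mem' := by
    rintro f ⟨σ, h⟩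
    refine ⟨σ⁻¹, ?_⟩
    intro X
    simpa using h.inv (by simp) X

/-- Every bijection between cofinite subsets of `ℕ` induces an automorphism of `P(ℕ)/fin`. -/
theorem exists_inducedBy (e : PartialEquiv ℕ ℕ) (hs : e.sourceᶜ.Finite) (ht : e.targetᶜ.Finite) :
    ∃ f : BoolAut PNFin, InducedBy f e := by
  have mono : ∀ (e : PartialEquiv ℕ ℕ) (X Y : Set ℕ), (X \ Y).Finite →
      ((e '' (X ∩ e.source)) \ (e '' (Y ∩ e.source))).Finite := by
    intro e X Y h
    refine (h.image e).subset ?_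
    rintro _ ⟨⟨x, hx, rfl⟩, hn⟩
    exact ⟨x, ⟨hx.1, fun hy => hn ⟨x, ⟨hy, hx.2⟩, rfl⟩⟩, rfl⟩
  let F : PartialEquiv ℕ ℕ → PNFin → PNFin := fun e =>
    Quotient.map (fun X => e '' (X ∩ e.source)) (fun X Y h => by
      have h' := BoolQuotient.symmDiff_mem.1 h
      exact BoolQuotient.symmDiff_mem.2 ⟨mono e _ _ h'.1, mono e _ _ h'.2⟩)
  have Fmono : ∀ e, Monotone (F e) := by
    rintro e ⟨X⟩ ⟨Y⟩ h
    exact mono e X Y h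
  have key : ∀ e : PartialEquiv ℕ ℕ, e.sourceᶜ.Finite → ∀ a, F e.symm (F e a) = a := by
    rintro e hs ⟨X⟩
    refine BoolQuotient.mk_eq_mk.2 (BoolQuotient.symmDiff_mem.2 ⟨?_, hs.subset ?_⟩)
    · refine Set.finite_empty.subset ?_
      rintro _ ⟨⟨_, ⟨⟨x, hx, rfl⟩, -⟩, rfl⟩, hn⟩
      rw [e.left_inv hx.2] at hn
      exact hn hx.1
    · rintro x ⟨hX, hn⟩ hx
      exact hn ⟨e x, ⟨⟨x, ⟨hX, hx⟩, rfl⟩, e.map_source hx⟩, e.left_inv hx⟩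
  exact ⟨Equiv.toOrderIso ⟨F e, F e.symm, key e hs, key e.symm ht⟩ (Fmono e) (Fmono e.symm),
    fun X => rfl⟩

/-- Permutations of `ℕ` induce the same automorphism iff they differ at finitely many points. -/
theorem inducedBy_unique {f g : BoolAut PNFin} {σ τ : Equiv.Perm ℕ}
    (hf : InducedBy f σ.toPartialEquiv) (hg : InducedBy g τ.toPartialEquiv) :
    f = g ↔ {n | σ n ≠ τ n}.Finite := by
  have hf' : ∀ X, f (PNFin.mk X) = PNFin.mk (σ '' X) := fun X => by simpa using hf X
  have hg' : ∀ X, g (PNFin.mk X) = PNFin.mk (τ '' X) := fun X => by simpa using hg X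
  constructor
  · rintro rfl
    by_contra hinf
    obtain ⟨u, hu, hr⟩ := exists_seq_of_forall_finset_exists (fun n => σ n ≠ τ n)
      (fun x y => x ≠ y ∧ σ x ≠ τ y ∧ σ y ≠ τ x) (fun s _ => by
        obtain ⟨y, hy, hn⟩ := Set.Infinite.exists_notMem_finset hinf
          (s ∪ s.image (fun x => τ.symm (σ x)) ∪ s.image (fun x => σ.symm (τ x)))
        refine ⟨y, hy, fun x hx => ⟨?_, ?_, ?_⟩⟩
        · rintro rfl; simp [hx] at hn
        · intro h
          apply hn
          simp only [Finset.mem_union, Finset.mem_image]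
          exact Or.inl (Or.inr ⟨x, hx, by simp [h]⟩)
        · intro h
          apply hn
          simp only [Finset.mem_union, Finset.mem_image]
          exact Or.inr ⟨x, hx, by simp [← h]⟩)
    have hinj : Function.Injective u := by
      intro m n h
      rcases lt_trichotomy m n with h' | h' | h'
      · exact absurd h (hr m n h').1
      · exact h'
      · exact absurd h.symm (hr n m h').1
    have hX := BoolQuotient.mk_eq_mk.1 ((hf' (Set.range u)).symm.trans (hg' (Set.range u)))
    have hfin : (σ '' Set.range u).Finite := by
      refine (BoolQuotient.symmDiff_mem.1 hX).1.subset ?_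
      rintro _ ⟨_, ⟨m, rfl⟩, rfl⟩
      refine ⟨⟨_, ⟨m, rfl⟩, rfl⟩, ?_⟩
      rintro ⟨_, ⟨n, rfl⟩, h⟩
      rcases lt_trichotomy m n with h' | h' | h'
      · exact (hr m n h').2.1 h.symm
      · subst h'; exact hu m h.symm
      · exact (hr n m h').2.2 h.symm
    exact Set.infinite_range_of_injective hinj
      (Set.Finite.of_finite_image hfin σ.injective.injOn)
  · intro hfin
    ext a
    obtain ⟨X, rfl⟩ := BoolQuotient.mk_surjective a
    have h : f (PNFin.mk X) = g (PNFin.mk X) := by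
      rw [hf', hg']
      refine BoolQuotient.mk_eq_mk.2 (BoolQuotient.symmDiff_mem.2
        ⟨(hfin.image σ).subset ?_, (hfin.image τ).subset ?_⟩)
      · rintro _ ⟨⟨x, hx, rfl⟩, hn⟩
        exact ⟨x, fun h => hn ⟨x, hx, h.symm⟩, rfl⟩
      · rintro _ ⟨⟨x, hx, rfl⟩, hn⟩
        exact ⟨x, fun h => hn ⟨x, hx, h⟩, rfl⟩
    exact h

open Filter Topology
open scoped ENNReal

/-! ## Families of elements commuting off the diagonal -/

/-- Uncountably many pairs `(a i, b i)` of non-commuting elements such that `a i` commutes with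
`b j` whenever `i ≠ j`. -/
def HasOffDiagonalCommutingFamily (G : Type*) [Mul G] : Prop :=
  ∃ a b : (ℕ → Bool) → G,
    (∀ i j, i ≠ j → Commute (a i) (b j)) ∧ ∀ i, ¬ Commute (a i) (b i)

theorem HasOffDiagonalCommutingFamily.map {G H : Type*} [Mul G] [Mul H]
    (h : HasOffDiagonalCommutingFamily G) (φ : G →ₙ* H) (hφ : Function.Injective φ) :
    HasOffDiagonalCommutingFamily H := by
  obtain ⟨a, b, hab, hne⟩ := h
  refine ⟨fun i => φ (a i), fun i => φ (b i), fun i j hij => (hab i j hij).map φ, fun i hi => ?_⟩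
  apply hne i
  apply hφ
  rw [map_mul, map_mul]
  exact hi

/-- Uncountably many pairs of continuous self-maps of a second countable Hausdorff space cannot
commute exactly off the diagonal. -/
theorem exists_comm_of_comm_off_diagonal {X ι : Type*} [TopologicalSpace X]
    [SecondCountableTopology X] [T2Space X] [Uncountable ι] {a b : ι → X → X}
    (ha : ∀ i, Continuous (a i)) (hb : ∀ i, Continuous (b i))
    (hab : ∀ i j, i ≠ j → ∀ x, a i (b j x) = b j (a i x)) :
    ∃ i, ∀ x, a i (b i x) = b i (a i x) := by
  by_contra! hne
  choose x hx using hne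
  let B := TopologicalSpace.countableBasis X
  have hB : TopologicalSpace.IsTopologicalBasis B := TopologicalSpace.isBasis_countableBasis X
  -- `U` and `V` separate the two composites at `x i`; `P` and `Q` surround the intermediate values,
  -- `R` the point itself.
  have key : ∀ i, ∃ U V P Q R : B, Disjoint (U : Set X) V ∧
      b i (x i) ∈ (P : Set X) ∧ a i (x i) ∈ (Q : Set X) ∧ x i ∈ (R : Set X) ∧
      Set.MapsTo (a i) P U ∧ Set.MapsTo (b i) Q V ∧
      Set.MapsTo (a i) R Q ∧ Set.MapsTo (b i) R P := by
    intro i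
    obtain ⟨u, v, hu, hv, hxu, hxv, huv⟩ := t2_separation (hx i)
    obtain ⟨U, hU, hxU, hUu⟩ := hB.exists_subset_of_mem_open hxu hu
    obtain ⟨V, hV, hxV, hVv⟩ := hB.exists_subset_of_mem_open hxv hv
    obtain ⟨P, hP, hxP, hPU⟩ := hB.exists_subset_of_mem_open (a := b i (x i))
      (u := a i ⁻¹' U) hxU ((hB.isOpen hU).preimage (ha i))
    obtain ⟨Q, hQ, hxQ, hQV⟩ := hB.exists_subset_of_mem_open (a := a i (x i))
      (u := b i ⁻¹' V) hxV ((hB.isOpen hV).preimage (hb i))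
    obtain ⟨R, hR, hxR, hRPQ⟩ := hB.exists_subset_of_mem_open (a := x i)
      (u := a i ⁻¹' Q ∩ b i ⁻¹' P) ⟨hxQ, hxP⟩
      (((hB.isOpen hQ).preimage (ha i)).inter ((hB.isOpen hP).preimage (hb i)))
    exact ⟨⟨U, hU⟩, ⟨V, hV⟩, ⟨P, hP⟩, ⟨Q, hQ⟩, ⟨R, hR⟩, huv.mono hUu hVv, hxP, hxQ, hxR,
      hPU, hQV, fun y hy => (hRPQ hy).1, fun y hy => (hRPQ hy).2⟩
  choose U V P Q R hUV hbP haQ hxR haU hbV haRQ hbRP using key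
  have : Countable B := (TopologicalSpace.countable_countableBasis X).to_subtype
  have hninj : ¬ Function.Injective fun i => (U i, V i, P i, Q i, R i) :=
    fun h => not_countable h.countable
  simp only [Function.Injective, not_forall, Prod.mk.injEq] at hninj
  obtain ⟨i, j, ⟨hU, hV, hP, hQ, hR⟩, hij⟩ := hninj
  -- With shared witnesses, `a i` and `b j` tested at `x j` land in the disjoint sets `U i` and `V
  -- i`.
  have h1 : a i (b j (x j)) ∈ (U i : Set X) := haU i (hP ▸ hbP j)
  have h2 : a i (x j) ∈ (Q j : Set X) := hQ ▸ haRQ i (hR ▸ hxR j)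
  have h3 : b j (a i (x j)) ∈ (V i : Set X) := hV ▸ hbV j h2
  exact Set.disjoint_left.1 (hUV i) h1 (hab i j hij (x j) ▸ h3)

/-! ## The metric of a finite measure algebra -/

namespace MeasAlg

variable {X : Type*} [MeasurableSpace X] {μ : Measure X}

theorem exists_rep (a : MeasAlg μ) :
    ∃ s : {s : Set X // MeasurableSet s}, BoolQuotient.mk (nullIdeal μ) s = a :=
  BoolQuotient.mk_surjective a

theorem meas_mk (s : {s : Set X // MeasurableSet s}) :
    meas μ (BoolQuotient.mk (nullIdeal μ) s) = μ (s : Set X) := rfl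

theorem mk_le_mk_iff {s t : {s : Set X // MeasurableSet s}} :
    BoolQuotient.mk (nullIdeal μ) s ≤ BoolQuotient.mk (nullIdeal μ) t ↔
      (s : Set X) ≤ᵐ[μ] (t : Set X) :=
  ae_le_set.symm

theorem mk_eq_mk_iff {s t : {s : Set X // MeasurableSet s}} :
    BoolQuotient.mk (nullIdeal μ) s = BoolQuotient.mk (nullIdeal μ) t ↔
      (s : Set X) =ᵐ[μ] (t : Set X) :=
  BoolQuotient.mk_eq_mk.trans measure_symmDiff_eq_zero_iff

theorem meas_mono {a b : MeasAlg μ} (h : a ≤ b) : meas μ a ≤ meas μ b := by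
  obtain ⟨s, rfl⟩ := exists_rep a
  obtain ⟨t, rfl⟩ := exists_rep b
  exact measure_mono_ae (mk_le_mk_iff.1 h)

theorem meas_eq_zero {a : MeasAlg μ} : meas μ a = 0 ↔ a = ⊥ := by
  obtain ⟨s, rfl⟩ := exists_rep a
  exact (ae_eq_empty.symm.trans (mk_eq_mk_iff (t := ⊥)).symm)

theorem mk_symmDiff (s t : {s : Set X // MeasurableSet s}) :
    symmDiff (BoolQuotient.mk (nullIdeal μ) s) (BoolQuotient.mk (nullIdeal μ) t) =
      BoolQuotient.mk (nullIdeal μ) (symmDiff s t) := by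
  rw [symmDiff_eq, symmDiff_eq]
  rfl

/-- An automorphism of a finite measure algebra is absolutely continuous. -/
theorem exists_meas_map_lt [IsFiniteMeasure μ] (f : BoolAut (MeasAlg μ)) {ε : ℝ≥0∞}
    (hε : 0 < ε) : ∃ δ : ℝ≥0∞, 0 < δ ∧ ∀ a, meas μ a < δ → meas μ (f a) < ε := by
  by_contra! h
  choose a ha hfa using fun n : ℕ => h ((2 : ℝ≥0∞)⁻¹ ^ n) (by
    exact ENNReal.pow_pos (by simp) n)
  choose s hs using fun n => exists_rep (a n)
  -- Tail unions: decreasing with measure tending to zero, while each image still has measure at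
  -- least `ε`.
  let T : ℕ → {s : Set X // MeasurableSet s} := fun n =>
    ⟨⋃ k, (s (n + k) : Set X), MeasurableSet.iUnion fun k => (s (n + k)).2⟩
  have hT : ∀ n, μ (T n : Set X) ≤ (2 : ℝ≥0∞)⁻¹ ^ n * 2 := by
    intro n
    calc μ (T n : Set X) ≤ ∑' k, μ (s (n + k) : Set X) := measure_iUnion_le _
      _ ≤ ∑' k, (2 : ℝ≥0∞)⁻¹ ^ (n + k) := by
          refine ENNReal.tsum_le_tsum fun k => ?_
          rw [← meas_mk (μ := μ), hs]
          exact (ha _).le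
      _ = (2 : ℝ≥0∞)⁻¹ ^ n * 2 := by
          simp_rw [pow_add]
          rw [ENNReal.tsum_mul_left, ENNReal.tsum_geometric, ENNReal.one_sub_inv_two, inv_inv]
  have hT0 : Tendsto (fun n => μ (T n : Set X)) atTop (𝓝 0) := by
    refine tendsto_of_tendsto_of_tendsto_of_le_of_le tendsto_const_nhds ?_
      (fun _ => zero_le) hT
    have := ENNReal.Tendsto.mul_const (b := 2)
      (ENNReal.tendsto_pow_atTop_nhds_zero_of_lt_one (r := (2 : ℝ≥0∞)⁻¹) (by simp))
      (Or.inr (by simp))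
    simpa using this
  choose R hR using fun n => exists_rep (f (BoolQuotient.mk (nullIdeal μ) (T n)))
  have hTanti : ∀ m n, m ≤ n → (T n : Set X) ⊆ T m := by
    intro m n hmn
    refine Set.iUnion_subset fun k => ?_
    rw [show n + k = m + (n - m + k) by omega]
    exact Set.subset_iUnion (fun k => (s (m + k) : Set X)) _
  have hRanti : ∀ m n, m ≤ n → (R n : Set X) ≤ᵐ[μ] (R m : Set X) := by
    intro m n hmn
    rw [← mk_le_mk_iff, hR, hR, f.le_iff_le]
    exact BoolQuotient.mk_mono (hTanti m n hmn)
  have hRε : ∀ n, ε ≤ μ (R n : Set X) := by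
    intro n
    rw [← meas_mk (μ := μ), hR]
    refine (hfa n).trans (meas_mono (f.monotone ?_))
    rw [← hs]
    exact BoolQuotient.mk_mono (Set.subset_iUnion (fun k => (s (n + k) : Set X)) 0)
  let L : {s : Set X // MeasurableSet s} :=
    ⟨⋂ n, (R n : Set X), MeasurableSet.iInter fun n => (R n).2⟩
  -- The preimage of `L` lies below every `T n`, hence is null; monotonicity of `f.symm` is enough.
  have hL : BoolQuotient.mk (nullIdeal μ) L = ⊥ := by
    rw [← map_eq_bot_iff f.symm, ← meas_eq_zero]
    refine le_antisymm (ge_of_tendsto' hT0 fun n => ?_) zero_le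
    rw [← meas_mk (μ := μ)]
    apply meas_mono
    rw [OrderIso.symm_apply_le, ← hR]
    exact BoolQuotient.mk_mono (Set.iInter_subset (fun n => (R n : Set X)) n)
  -- The `R n` decrease only almost everywhere, so continuity from above is applied to their finite
  -- intersections.
  have hlim : Tendsto (fun n => μ (⋂ k ≤ n, (R k : Set X))) atTop
      (𝓝 (μ (⋂ n, (R n : Set X)))) :=
    tendsto_measure_iInter_le (fun n => (R n).2.nullMeasurableSet) ⟨0, measure_ne_top _ _⟩
  have hle : ε ≤ μ (⋂ n, (R n : Set X)) := by
    refine ge_of_tendsto' hlim fun n => (hRε n).trans (measure_mono_ae ?_)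
    have hall : ∀ᵐ x ∂μ, ∀ k, k ≤ n → x ∈ (R n : Set X) → x ∈ (R k : Set X) :=
      ae_all_iff.2 fun k => by
        by_cases hk : k ≤ n
        · filter_upwards [hRanti k n hk] with x hx _ using hx
        · exact Eventually.of_forall fun x h => absurd h hk
    filter_upwards [hall] with x hx hxn
    exact Set.mem_iInter₂.2 fun k hk => hx k hk hxn
  have : μ (⋂ n, (R n : Set X)) = 0 := meas_eq_zero.2 hL
  exact (hε.trans_le hle).ne' this

/-- The embedding of a finite measure algebra into `L¹` by indicator functions. -/
noncomputable def toL1 [IsFiniteMeasure μ] : MeasAlg μ → Lp ℝ 1 μ :=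
  Quotient.lift (s := idealSetoid (nullIdeal μ))
    (fun s => indicatorConstLp 1 s.2 (measure_ne_top μ _) (1 : ℝ)) (fun s t h =>
      (indicatorConstLp_inj s.2 (measure_ne_top μ _) t.2 (measure_ne_top μ _) one_ne_zero).2
        (measure_symmDiff_eq_zero_iff.1 h))

theorem toL1_injective [IsFiniteMeasure μ] : Function.Injective (toL1 (μ := μ)) := by
  intro a b h
  obtain ⟨s, rfl⟩ := exists_rep a
  obtain ⟨t, rfl⟩ := exists_rep b
  exact mk_eq_mk_iff.2 ((indicatorConstLp_inj s.2 (measure_ne_top μ _) t.2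
    (measure_ne_top μ _) one_ne_zero).1 h)

theorem edist_toL1 [IsFiniteMeasure μ] (a b : MeasAlg μ) :
    edist (toL1 a) (toL1 b) = meas μ (symmDiff a b) := by
  obtain ⟨s, rfl⟩ := exists_rep a
  obtain ⟨t, rfl⟩ := exists_rep b
  rw [mk_symmDiff, meas_mk]
  change edist (indicatorConstLp 1 s.2 (measure_ne_top μ _) (1 : ℝ))
    (indicatorConstLp 1 t.2 (measure_ne_top μ _) (1 : ℝ)) = _
  rw [edist_indicatorConstLp_eq_enorm]
  rw [indicatorConstLp, Lp.enorm_toLp, eLpNorm_indicator_const (s.2.symmDiff t.2) one_ne_zero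
    ENNReal.one_ne_top]
  simp
  rfl

noncomputable instance [IsFiniteMeasure μ] : MetricSpace (MeasAlg μ) :=
  MetricSpace.induced toL1 toL1_injective inferInstance

theorem edist_eq_meas [IsFiniteMeasure μ] (a b : MeasAlg μ) :
    edist a b = meas μ (symmDiff a b) :=
  edist_toL1 a b

/-- Inherited from the separability of `L¹` over a countably generated σ-algebra. -/
instance [IsFiniteMeasure μ] [MeasurableSpace.CountablyGenerated X] :
    SecondCountableTopology (MeasAlg μ) :=
  have : Fact ((1 : ℝ≥0∞) ≠ ∞) := ⟨ENNReal.one_ne_top⟩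
  (Topology.IsInducing.mk rfl : Topology.IsInducing (toL1 (μ := μ))).secondCountableTopology

/-- Automorphisms preserve symmetric differences, so continuity everywhere reduces to absolute
continuity. -/
theorem continuous_boolAut [IsFiniteMeasure μ] (f : BoolAut (MeasAlg μ)) : Continuous f := by
  rw [EMetric.continuous_iff]
  intro a ε hε
  obtain ⟨δ, hδ, h⟩ := exists_meas_map_lt f hε
  refine ⟨δ, hδ, fun b hb => ?_⟩
  rw [edist_eq_meas] at hb ⊢
  rw [← map_symmDiff']
  exact h _ hb

theorem not_hasOffDiagonalCommutingFamily_boolAut [IsFiniteMeasure μ]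
    [MeasurableSpace.CountablyGenerated X] :
    ¬ HasOffDiagonalCommutingFamily (BoolAut (MeasAlg μ)) := by
  rintro ⟨a, b, hab, hne⟩
  have : Uncountable (ℕ → Bool) := by
    rw [← Cardinal.aleph0_lt_mk_iff]
    simpa using Cardinal.cantor Cardinal.aleph0
  obtain ⟨i, hi⟩ := exists_comm_of_comm_off_diagonal (a := fun i => a i) (b := fun i => b i)
    (fun i => continuous_boolAut (a i)) (fun i => continuous_boolAut (b i))
    (fun i j hij x => DFunLike.congr_fun (hab i j hij).eq x)
  exact hne i (DFunLike.ext _ _ hi)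

end MeasAlg

/-! ## Permutations along the branches of the binary tree -/

/-- The set of finite initial segments of `x`. -/
def initialSegments (x : ℕ → Bool) : Set (List Bool) :=
  {l | l = (List.range l.length).map x}

theorem map_range_mem_initialSegments (x : ℕ → Bool) (n : ℕ) :
    (List.range n).map x ∈ initialSegments x := by
  simp [initialSegments]

theorem infinite_initialSegments (x : ℕ → Bool) : (initialSegments x).Infinite := by
  refine Set.infinite_of_injective_forall_mem (f := fun n => (List.range n).map x) ?_
    (map_range_mem_initialSegments x)
  intro m n h
  simpa using congrArg List.length h

/-- A segment longer than a place where the branches differ records that place, so it cannot be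
common. -/
theorem finite_initialSegments_inter {x y : ℕ → Bool} (h : x ≠ y) :
    (initialSegments x ∩ initialSegments y).Finite := by
  obtain ⟨m, hm⟩ := Function.ne_iff.1 h
  refine ((Set.finite_Iic m).image fun n => (List.range n).map x).subset ?_
  rintro l ⟨hx, hy⟩
  refine ⟨l.length, ?_, hx.symm⟩
  by_contra hlt
  rw [Set.mem_Iic, not_le] at hlt
  have h1 : (List.range l.length).map x = (List.range l.length).map y := hx.symm.trans hy
  exact hm (List.map_inj_left.1 h1 m (List.mem_range.2 hlt))

open Classical in
/-- The permutation of `ℕ ≃ α × Fin 3` acting as `σ` on the fibres over `S` and trivially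
elsewhere. -/
noncomputable def fiberPerm {α : Type*} (e : α × Fin 3 ≃ ℕ) (S : Set α) (σ : Equiv.Perm (Fin 3)) :
    Equiv.Perm ℕ :=
  e.permCongr (Equiv.prodShear (Equiv.refl α) fun l => if l ∈ S then σ else 1)

section fiberPerm

variable {α : Type*} (e : α × Fin 3 ≃ ℕ) (S : Set α) (σ : Equiv.Perm (Fin 3))

open Classical in
theorem fiberPerm_apply (l : α) (k : Fin 3) :
    fiberPerm e S σ (e (l, k)) = e (l, if l ∈ S then σ k else k) := by
  by_cases h : l ∈ S <;> simp [fiberPerm, h]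

/-- Outside the fibres over `S ∩ T` at most one factor moves anything. -/
theorem finite_fiberPerm_ne {S T : Set α} (h : (S ∩ T).Finite) (σ τ : Equiv.Perm (Fin 3)) :
    {n | (fiberPerm e S σ * fiberPerm e T τ) n ≠
      (fiberPerm e T τ * fiberPerm e S σ) n}.Finite := by
  refine ((h.prod (Set.finite_univ (α := Fin 3))).image e).subset ?_
  intro n hn
  obtain ⟨⟨l, k⟩, rfl⟩ := e.surjective n
  refine ⟨(l, k), ⟨?_, Set.mem_univ _⟩, rfl⟩
  by_contra hl
  apply hn
  simp only [Equiv.Perm.mul_apply, fiberPerm_apply]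
  by_cases hS : l ∈ S <;> by_cases hT : l ∈ T
  · exact absurd ⟨hS, hT⟩ hl
  all_goals simp [hS, hT]

theorem infinite_fiberPerm_ne (hS : S.Infinite) {σ τ : Equiv.Perm (Fin 3)} {k : Fin 3}
    (h : σ (τ k) ≠ τ (σ k)) :
    {n | (fiberPerm e S σ * fiberPerm e S τ) n ≠
      (fiberPerm e S τ * fiberPerm e S σ) n}.Infinite := by
  refine (hS.image (f := fun l => e (l, k)) ?_).mono ?_
  · intro l _ l' _ hl
    simpa using hl
  · rintro _ ⟨l, hl, rfl⟩
    simpa [Equiv.Perm.mul_apply, fiberPerm_apply, hl] using h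

end fiberPerm

/-! ### Transfer to the automorphism groups -/

theorem inducedBy_perm_mul {f g : BoolAut PNFin} {σ τ : Equiv.Perm ℕ}
    (hf : InducedBy f σ.toPartialEquiv) (hg : InducedBy g τ.toPartialEquiv) :
    InducedBy (f * g) (σ * τ).toPartialEquiv := by
  intro X
  simpa using hf.mul hg X

theorem commute_iff_of_inducedBy {f g : BoolAut PNFin} {σ τ : Equiv.Perm ℕ}
    (hf : InducedBy f σ.toPartialEquiv) (hg : InducedBy g τ.toPartialEquiv) :
    Commute f g ↔ {n | (σ * τ) n ≠ (τ * σ) n}.Finite :=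
  inducedBy_unique (inducedBy_perm_mul hf hg) (inducedBy_perm_mul hg hf)

theorem veryTrivialAut_le_trivialAut : VeryTrivialAut ≤ TrivialAut := by
  rintro f ⟨σ, h⟩
  exact ⟨σ.toPartialEquiv, by simp, by simp, h⟩

theorem hasOffDiagonalCommutingFamily_veryTrivialAut :
    HasOffDiagonalCommutingFamily VeryTrivialAut := by
  choose F hF using fun σ : Equiv.Perm ℕ =>
    exists_inducedBy σ.toPartialEquiv (by simp) (by simp)
  let F' : Equiv.Perm ℕ → VeryTrivialAut := fun σ => ⟨F σ, σ, hF σ⟩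
  have hcomm : ∀ σ τ, Commute (F' σ) (F' τ) ↔ {n | (σ * τ) n ≠ (τ * σ) n}.Finite := by
    intro σ τ
    rw [← commute_iff_of_inducedBy (hF σ) (hF τ)]
    exact Subtype.ext_iff
  obtain ⟨e⟩ : Nonempty (List Bool × Fin 3 ≃ ℕ) := nonempty_equiv_of_countable
  refine ⟨fun x => F' (fiberPerm e (initialSegments x) (Equiv.swap 0 1)),
    fun x => F' (fiberPerm e (initialSegments x) (Equiv.swap 1 2)), fun x y hxy => ?_,
    fun x hx => ?_⟩
  · exact (hcomm _ _).2 (finite_fiberPerm_ne e (finite_initialSegments_inter hxy) _ _)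
  -- The two composites of the transpositions send `0` to `1` and to `2`.
  · exact infinite_fiberPerm_ne e _ (infinite_initialSegments x) (k := 0) (by decide)
      ((hcomm _ _).1 hx)

theorem hasOffDiagonalCommutingFamily_trivialAut : HasOffDiagonalCommutingFamily TrivialAut :=
  hasOffDiagonalCommutingFamily_veryTrivialAut.map
    (Subgroup.inclusion veryTrivialAut_le_trivialAut : _ →ₙ* _)
    (Subgroup.inclusion_injective veryTrivialAut_le_trivialAut)

theorem not_hasOffDiagonalCommutingFamily_MPAut : ¬ HasOffDiagonalCommutingFamily MPAut :=
  fun h => MeasAlg.not_hasOffDiagonalCommutingFamily_boolAut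
    (h.map (MPAut.subtype : MPAut →ₙ* BoolAut LebesgueAlg) MPAut.subtype_injective)

theorem HasOffDiagonalCommutingFamily.isEmpty_mulEquiv {G H : Type*} [Mul G] [Mul H]
    (hH : HasOffDiagonalCommutingFamily H) (hG : ¬ HasOffDiagonalCommutingFamily G) :
    IsEmpty (G ≃* H) :=
  ⟨fun e => hG (hH.map (e.symm : H →ₙ* G) e.symm.injective)⟩

theorem theorem2p5 :
    IsEmpty (BoolAut LebesgueAlg ≃* TrivialAut) ∧
    IsEmpty (BoolAut LebesgueAlg ≃* VeryTrivialAut) ∧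
    IsEmpty (MPAut ≃* TrivialAut) ∧
    IsEmpty (MPAut ≃* VeryTrivialAut) := by
  have hM := MeasAlg.not_hasOffDiagonalCommutingFamily_boolAut (μ := (volume : Measure unitInterval))
  exact ⟨hasOffDiagonalCommutingFamily_trivialAut.isEmpty_mulEquiv hM,
    hasOffDiagonalCommutingFamily_veryTrivialAut.isEmpty_mulEquiv hM,
    hasOffDiagonalCommutingFamily_trivialAut.isEmpty_mulEquiv
      not_hasOffDiagonalCommutingFamily_MPAut,
    hasOffDiagonalCommutingFamily_veryTrivialAut.isEmpty_mulEquiv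
      not_hasOffDiagonalCommutingFamily_MPAut⟩
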